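/- Let $\tau=\{E,<,+,\times\}$ be the relational vocabulary with $E,<$ binary and $+,\times$ ternary, and for $m\in\mathbb N$ let $C(m)=\{\overline\ell : \ell<m\}$ be a set of $m$ constant symbols. A $\tau$-structure $\mathcal A$ with nonempty finite universe $A$ has \emph{built-in $<,+,\times$} if there is a (necessarily unique) bijection from $A$ onto $[n]=\{0,\dots,n-1\}$, $n=|A|$, that carries $<^{\mathcal A}$ to the natural order of $[n]$, and $+^{\mathcal A}$, $\times^{\mathcal A}$ to the relations $\{(a,b,c)\in[n]^3 : c=a+b\}$ and $\{(a,b,c)\in[n]^3 : c=a\cdot b\}$. In this case $\mathcal A_{C(m)}$ denotes the expansion of $\mathcal A$ in which $\overline\ell$ is interpreted by the element corresponding to $\ell$ if $\ell<n$, and by the element corresponding to $n-1$ if $\ell\ge n$. The \emph{parameterized vertex cover problem} is the class of all pairs $(\mathcal A,k)$ with $k\in\mathbb N$ and $\mathcal A$ a $\tau$-structure with built-in $<,+,\times$ such that $(A,E^{\mathcal A})$ is a (simple, undirected) graph having a vertex cover of size $k$, that is, a set of exactly $k$ vertices containing at least one endpoint of every edge. \textbf{Theorem.} The parameterized vertex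 cover problem is slicewise definable in $\mathrm{FO}_{16}$. That is, there are computable functions $h:\mathbb N\to\mathbb N$ and $k\mapsto\varphi_k$, where each $\varphi_k$ is a first-order sentence of vocabulary $\tau\cup C(h(k))$ and of quantifier rank at most $16$, such that for all $k\in\mathbb N$ and all $\tau$-structures $\mathcal A$ with built-in $<,+,\times$: $\mathcal A_{C(h(k))}\models\varphi_k$ if and only if $\mathcal A$ is a graph (i.e. $(A,E^{\mathcal A})$ is one) that has a vertex cover of size $k$. -/

import Mathlib

universe u

namespace SlicewiseFO

open FirstOrder FirstOrder.Language

/-- The quantifier rank of a first-order formula. (In Mathlib's syntax the formulas are built from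
atomic formulas and `⊥` by implication and universal quantification; `¬`, `∧`, `∨`, `∃` are
abbreviations, and on them this function takes the usual values.) -/
def quantifierRank {L : FirstOrder.Language} {α : Type*} : ∀ {n : ℕ}, L.BoundedFormula α n → ℕ
  | _, .falsum => 0
  | _, .equal _ _ => 0
  | _, .rel _ _ => 0
  | _, .imp f g => max (quantifierRank f) (quantifierRank g)
  | _, .all f => 1 + quantifierRank f

/-- The relation symbols `E`, `<` (binary) and `+`, `×` (ternary). -/
inductive GraphRel : ℕ → Type
  | edge : GraphRel 2
  | lt : GraphRel 2
  | add : GraphRel 3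
  | mul : GraphRel 3

/-- The relational vocabulary `τ = {E, <, +, ×}` of graphs with arithmetic. -/
def tauGraph : FirstOrder.Language.{0, 0} := ⟨fun _ => Empty, GraphRel⟩

/-- The vocabulary `τ ∪ C(m)`, where `C(m)` consists of `m` constant symbols, one for each number
`ℓ < m`. -/
abbrev tauGraphC (m : ℕ) : FirstOrder.Language.{0, 0} := tauGraph.withConstants (Fin m)

section Structures

variable (V : Type u) [tauGraph.Structure V]

variable {V} in
/-- The relation `E` of a `τ`-structure. -/
def Edge (a b : V) : Prop := Structure.RelMap (L := tauGraph) GraphRel.edge ![a, b]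

variable {V} in
/-- The relation `<` of a `τ`-structure. -/
def LtRel (a b : V) : Prop := Structure.RelMap (L := tauGraph) GraphRel.lt ![a, b]

variable {V} in
/-- The relation `+` of a `τ`-structure. -/
def AddRel (a b c : V) : Prop := Structure.RelMap (L := tauGraph) GraphRel.add ![a, b, c]

variable {V} in
/-- The relation `×` of a `τ`-structure. -/
def MulRel (a b c : V) : Prop := Structure.RelMap (L := tauGraph) GraphRel.mul ![a, b, c]

/-- An isomorphism from the `{<, +, ×}`-reduct of a `τ`-structure onto `[n] = {0, …, n - 1}` with
the natural order and with (the graphs of) addition and multiplication of natural numbers,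
restricted to `[n]`. For a given structure there is at most one. -/
structure ArithIso (n : ℕ) extends V ≃ Fin n where
  map_lt : ∀ a b : V, LtRel a b ↔ (toFun a : ℕ) < toFun b
  map_add : ∀ a b c : V, AddRel a b c ↔ (toFun c : ℕ) = toFun a + toFun b
  map_mul : ∀ a b c : V, MulRel a b c ↔ (toFun c : ℕ) = toFun a * toFun b

/-- The `τ`-structure has built-in `<`, `+`, `×`. (In particular it is finite.) -/
def IsArithm : Prop := ∃ n : ℕ, Nonempty (ArithIso V n)

variable {V}

theorem ArithIso.pos [Nonempty V] {n : ℕ} (e : ArithIso V n) : 0 < n :=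
  (e.toFun (Classical.arbitrary V)).pos

/-- The value of the constant symbol for `ℓ`: it is the element `ℓ` of `[n]` if `ℓ < n`, and the
element `n - 1` otherwise. -/
def ArithIso.const [Nonempty V] {n : ℕ} (e : ArithIso V n) (ℓ : ℕ) : V :=
  e.invFun ⟨if ℓ < n then ℓ else n - 1, by have := e.pos; split <;> omega⟩

/-- `A_{C(m)} ⊨ φ`, for the expansion `A_{C(m)}` of a structure `A` with built-in `<`, `+`, `×`
by the constants in `C(m)`. -/
def ArithIso.Models [Nonempty V] {n : ℕ} (e : ArithIso V n) {m : ℕ}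
    (φ : (tauGraphC m).Sentence) : Prop :=
  letI : (constantsOn (Fin m)).Structure V := constantsOn.structure fun ℓ => e.const ℓ
  Sentence.Realize V φ

end Structures

/-- A parameterized problem over the vocabulary `τ`: a class of pairs consisting of a (nonempty)
`τ`-structure with built-in `<`, `+`, `×` and of a natural number, the parameter, all of whose
slices are closed under isomorphism. -/
structure ParamProblem where
  /-- Membership of the pair of the structure `V` and the number `k`. -/
  Mem : ∀ (V : Type u) [Nonempty V] [tauGraph.Structure V], ℕ → Prop
  isArithm : ∀ (V : Type u) [Nonempty V] [tauGraph.Structure V] (k : ℕ), Mem V k → IsArithm V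
  iso_closed : ∀ (V W : Type u) [Nonempty V] [Nonempty W] [tauGraph.Structure V]
    [tauGraph.Structure W] (k : ℕ), Nonempty (V ≃[tauGraph] W) → Mem V k → Mem W k

/-- The index of a constant symbol. -/
def constCode {m : ℕ} : ∀ {r : ℕ}, (tauGraphC m).Functions r → ℕ
  | 0, .inr ℓ => Fin.val (n := m) ℓ

/-- A number for each relation symbol. -/
def relCode {m : ℕ} : ∀ {r : ℕ}, (tauGraphC m).Relations r → ℕ
  | _, .inl GraphRel.edge => 0
  | _, .inl GraphRel.lt => 1
  | _, .inl GraphRel.add => 2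
  | _, .inl GraphRel.mul => 3

/-- Gödel numbers of terms, that is, of variables and constants. -/
def termCode {m n : ℕ} : (tauGraphC m).Term (Empty ⊕ Fin n) → ℕ
  | .var (.inr i) => 2 * (i : ℕ)
  | .func f _ => 2 * constCode f + 1

/-- Gödel numbers of formulas of vocabulary `τ ∪ C(m)`. -/
def formulaCode {m : ℕ} : ∀ {n : ℕ}, (tauGraphC m).BoundedFormula Empty n → ℕ
  | _, .falsum => 0
  | _, .equal s t => 4 * Nat.pair (termCode s) (termCode t) + 1
  | _, .rel R ts =>
      4 * Nat.pair (relCode R) (Encodable.encode (List.ofFn fun i => termCode (ts i))) + 2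
  | _, .imp f g => 4 * Nat.pair (formulaCode f) (formulaCode g) + 3
  | _, .all f => 4 * formulaCode f + 4

/-- `Q` is slicewise definable in `FO_q`: there are computable functions `h` and `k ↦ φ k`, where
`φ k` is a sentence of vocabulary `τ ∪ C(h k)` and of quantifier rank at most `q`, such that
for every structure `A` with built-in `<`, `+`, `×` and every `k`, the pair `(A, k)` belongs to `Q`
if and only if `A_{C(h k)} ⊨ φ k`. -/
def SlicewiseDefinable (Q : ParamProblem.{u}) (q : ℕ) : Prop :=
  ∃ (h : ℕ → ℕ) (φ : ∀ k : ℕ, (tauGraphC (h k)).Sentence),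
    Computable h ∧
    Computable (fun k => formulaCode (φ k)) ∧
    (∀ k, quantifierRank (φ k) ≤ q) ∧
    ∀ (V : Type u) [Nonempty V] [tauGraph.Structure V] (n : ℕ) (e : ArithIso V n) (k : ℕ),
      Q.Mem V k ↔ e.Models (φ k)

/-- The parameterized vertex cover problem: the input is a graph with built-in `<`, `+`, `×`, the
parameter is `k`, and the question is whether the graph has a vertex cover of size `k`. -/
def pVC : ParamProblem.{u} where
  Mem V _ _ k := IsArithm V ∧ ∃ G : SimpleGraph V, (∀ a b : V, G.Adj a b ↔ Edge a b) ∧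
    ∃ C : Finset V, G.IsVertexCover (C : Set V) ∧ C.card = k
  isArithm _ _ _ _ h := h.1
  iso_closed := by
    rintro V W _ _ _ _ k ⟨f⟩ ⟨⟨n, ⟨e⟩⟩, G, hG, C, hC, hk⟩
    have h2 : ∀ (R : tauGraph.Relations 2) (a b : W), Structure.RelMap R ![a, b] ↔
        Structure.RelMap R ![f.symm a, f.symm b] := by
      intro R a b
      rw [← f.symm.map_rel R (![a, b])]
      exact iff_of_eq (congrArg _ (funext fun i => by fin_cases i <;> rfl))
    have h3 : ∀ (R : tauGraph.Relations 3) (a b c : W), Structure.RelMap R ![a, b, c] ↔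
        Structure.RelMap R ![f.symm a, f.symm b, f.symm c] := by
      intro R a b c
      rw [← f.symm.map_rel R (![a, b, c])]
      exact iff_of_eq (congrArg _ (funext fun i => by fin_cases i <;> rfl))
    refine ⟨⟨n, ⟨⟨f.symm.toEquiv.trans e.toEquiv, ?_, ?_, ?_⟩⟩⟩,
      G.map f.toEquiv.toEmbedding, ?_, C.map f.toEquiv.toEmbedding, ?_, ?_⟩
    · exact fun a b => (h2 GraphRel.lt a b).trans (e.map_lt _ _)
    · exact fun a b c => (h3 GraphRel.add a b c).trans (e.map_add _ _ _)
    · exact fun a b c => (h3 GraphRel.mul a b c).trans (e.map_mul _ _ _)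
    · intro a b
      refine Iff.trans ?_ ((hG (f.symm a) (f.symm b)).trans (h2 GraphRel.edge a b).symm)
      obtain ⟨a, rfl⟩ := f.surjective a
      obtain ⟨b, rfl⟩ := f.surjective b
      rw [f.symm_apply_apply, f.symm_apply_apply]
      exact SimpleGraph.map_adj_apply (f := f.toEquiv.toEmbedding)
    · intro a b hab
      obtain ⟨x, y, hxy, rfl, rfl⟩ := (SimpleGraph.map_adj _ _ _ _).1 hab
      simpa using hC hxy
    · rw [Finset.card_map, hk]

end SlicewiseFO

namespace SlicewiseFO

open FirstOrder FirstOrder.Language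

/-! The difficulty is to speak of `k` vertices with a quantifier rank independent of `k`. The remedy
is colour coding: a hash function `x ↦ q * (x % p) % p % M` is given by two quantified elements `p`,
`q`, and after that a vertex is addressed by constants naming colours. Choosing the colours costs
only a finite disjunction, which leaves the rank unchanged.

A colour class may contain many vertices, so one colour does not define a vertex. However, in a
minimal vertex cover `C` every `x` has a neighbour `g x` outside `C`. Let the hash function be
injective on `C` together with all `g x`, at most `2 * k` vertices. Then `x` is the only vertex that
has its colour and also has a neighbour of the colour of `g x`: another such vertex would lie
outside `C`, its neighbour would lie in `C` and share the colour of `g x`, hence equal `g x`, which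
is not in `C` (`exists_colors_of_cover`).

For `K = 2 * k`, `M = K ^ 2 + 1` and `n ≥ 4 ^ (K ^ 2 + 12)` such `p`, `q` exist: by a Chebyshev
bound some prime `p ≤ √n` keeps the elements distinct modulo `p`, and by a union bound some
multiplier `q` then separates their colours (`exists_hashColor_injOn`). As `p * p ≤ n`, the hash
function is computable by built-in arithmetic inside the structure (`ArithIso.colorRel_iff`). In
smaller structures all elements are named by constants.

Soundness needs no hashing: whatever the `k` formulas are, if each defines at most one vertex and
together they cover, then there is a cover of size at most `k`, which extends to size `k` when `k ≤
n`. -/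

/-! ### A family of hash functions -/

/-- The colour of `x` under the hash function with parameters `p`, `q` and with `M` colours. -/
def hashColor (p q M x : ℕ) : ℕ := q * (x % p) % p % M

theorem cubic_lt_two_pow {s : ℕ} (hs : 12 ≤ s) : 2 * s ^ 3 + 3 * s ^ 2 < 2 ^ s := by
  induction s, hs using Nat.le_induction with
  | base => norm_num
  | succ s hs ih =>
    rw [pow_succ 2 s]
    nlinarith [Nat.mul_le_mul hs hs, Nat.mul_le_mul (Nat.mul_le_mul hs hs) hs,
      Nat.mul_le_mul_left (s * s) hs]

/-- A Chebyshev lower bound for the number of primes: the least common multiple of the numbers up to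
`m` is at least `2 ^ m / (m + 1)`, and each prime contributes to it a power that is at most `m`. -/
theorem two_pow_le_pow_card_primesLE (m : ℕ) :
    2 ^ m ≤ (m + 1) ^ ((Nat.primesLE m).card + 1) := by
  refine (Chebyshev.two_pow_le_mul_lcmUpto m).trans ?_
  rw [Nat.lcmUpto_eq_prod_pow_log, pow_succ']
  refine Nat.mul_le_mul_left _ (Finset.prod_le_pow_card _ _ _ fun p hp => ?_)
  rcases Nat.eq_zero_or_pos m with rfl | hm
  · simp
  · exact (Nat.pow_log_le_self p hm.ne').trans (Nat.le_succ m)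

theorem two_pow_card_le_of_forall_dvd {S : Finset ℕ} (hS : ∀ p ∈ S, p.Prime) {D : ℕ} (hD : D ≠ 0)
    (h : ∀ p ∈ S, p ∣ D) : 2 ^ S.card ≤ D := by
  refine le_trans ?_ (Nat.le_of_dvd (Nat.pos_of_ne_zero hD)
    (Finset.prod_primes_dvd D (fun p hp => (hS p hp).prime) h))
  exact Finset.pow_card_le_prod _ _ _ fun p hp => (hS p hp).two_le

/-- Few large numbers can be told apart modulo a small prime. -/
theorem exists_prime_injOn_mod {X : Finset ℕ} {K n : ℕ} (hX : X.card ≤ K) (hlt : ∀ x ∈ X, x < n)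
    (hn : 4 ^ (K ^ 2 + 12) ≤ n) :
    ∃ p, p.Prime ∧ p * p ≤ n ∧ Set.InjOn (fun x => x % p) (X : Set ℕ) := by
  have hn0 : n ≠ 0 := by have : 0 < 4 ^ (K ^ 2 + 12) := by positivity
                         omega
  set L := Nat.log 2 n with hL
  have hnL : n < 2 ^ (L + 1) := Nat.lt_pow_succ_log_self one_lt_two n
  have hLn : 2 ^ L ≤ n := Nat.pow_log_le_self 2 hn0
  have hKL : 2 * (K ^ 2 + 12) ≤ L := by
    apply Nat.le_log_of_pow_le one_lt_two
    rwa [pow_mul]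
  obtain ⟨s, hs, hsL, hLs⟩ : ∃ s, K ^ 2 + 12 ≤ s ∧ 2 * s ≤ L ∧ L + 1 ≤ 2 * s + 2 :=
    ⟨L / 2, by omega, by omega, by omega⟩
  -- A prime fails to separate `X` only if it divides this product, which is too small to have many
  -- prime divisors.
  set D := ∏ z ∈ X.offDiag, Nat.dist z.1 z.2 with hD
  have hD0 : D ≠ 0 := Finset.prod_ne_zero_iff.2 fun z hz h0 =>
    (Finset.mem_offDiag.1 hz).2.2 (Nat.eq_of_dist_eq_zero h0)
  have hDle : D ≤ 2 ^ ((L + 1) * K ^ 2) := by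
    refine (Finset.prod_le_pow_card _ _ (2 ^ (L + 1)) fun z hz => ?_).trans ?_
    · have h := Finset.mem_offDiag.1 hz
      have h1 := hlt _ h.1
      have h2 := hlt _ h.2.1
      unfold Nat.dist; omega
    · rw [← pow_mul]
      refine Nat.pow_le_pow_right two_pos (Nat.mul_le_mul_left _ ?_)
      rw [Finset.offDiag_card]
      have := Nat.mul_le_mul hX hX
      rw [sq]; omega
  -- If all primes below `2 ^ s` divided `D`, there would be at most `(L + 1) * K ^ 2 ≤ (2 * s + 2)
  -- * (s - 12)` of them. The Chebyshev bound would then make `2 ^ s` at most cubic in `s`,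
  -- contradicting `cubic_lt_two_pow`.
  obtain ⟨p, hp, hpD⟩ : ∃ p ∈ Nat.primesLE (2 ^ s - 1), ¬ p ∣ D := by
    by_contra! hall
    have h1 := two_pow_card_le_of_forall_dvd
      (fun p hp => Nat.prime_of_mem_primesLE hp) hD0 hall
    have h2 : (Nat.primesLE (2 ^ s - 1)).card ≤ (L + 1) * K ^ 2 :=
      (Nat.pow_le_pow_iff_right one_lt_two).1 (h1.trans hDle)
    have h3 := two_pow_le_pow_card_primesLE (2 ^ s - 1)
    rw [Nat.sub_add_cancel Nat.one_le_two_pow, ← pow_mul] at h3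
    have h4 := (Nat.pow_le_pow_iff_right one_lt_two).1 h3
    have h5 := cubic_lt_two_pow (s := s) (by omega)
    have h6 : (L + 1) * K ^ 2 ≤ (2 * s + 2) * (s - 12) := Nat.mul_le_mul hLs (by omega)
    obtain ⟨v, rfl⟩ : ∃ v, s = v + 12 := ⟨s - 12, by omega⟩
    have h7 : (v + 12) * ((Nat.primesLE (2 ^ (v + 12) - 1)).card + 1)
        ≤ (v + 12) * ((2 * (v + 12) + 2) * v + 1) := Nat.mul_le_mul_left _ (by
          simp only [Nat.add_sub_cancel] at h6; omega)
    have h8 : 2 ^ (v + 12) - 1 ≤ (v + 12) * ((2 * (v + 12) + 2) * v + 1) := h4.trans h7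
    have h9 : (v + 12) * ((2 * (v + 12) + 2) * v + 1) + 1 ≤ 2 * (v + 12) ^ 3 + 3 * (v + 12) ^ 2 := by
      ring_nf; nlinarith [sq_nonneg v]
    omega
  obtain ⟨hple, hpp⟩ := Nat.mem_primesLE.1 hp
  have hps : p ≤ 2 ^ s := hple.trans (Nat.sub_le _ _)
  refine ⟨p, hpp, ?_, ?_⟩
  · calc p * p ≤ 2 ^ s * 2 ^ s := Nat.mul_le_mul hps hps
      _ = 2 ^ (2 * s) := by rw [← pow_add]; congr 1; ring
      _ ≤ 2 ^ L := Nat.pow_le_pow_right two_pos hsL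
      _ ≤ n := hLn
  · intro x hx y hy hxy
    by_contra hne
    apply hpD
    refine (?_ : p ∣ Nat.dist x y).trans
      (Finset.dvd_prod_of_mem (fun z : ℕ × ℕ => Nat.dist z.1 z.2) (a := (x, y))
        (Finset.mem_offDiag.2 ⟨hx, hy, hne⟩))
    have hxy' : x ≡ y [MOD p] := hxy
    rcases le_total x y with h | h
    · rw [Nat.dist_eq_sub_of_le h]
      exact (Nat.modEq_iff_dvd' h).1 hxy'
    · rw [Nat.dist_eq_sub_of_le_right h]
      exact (Nat.modEq_iff_dvd' h).1 hxy'.symm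

/-- A random multiplier separates two residues with high probability. -/
theorem card_bad_multipliers_le {p M a b : ℕ} (hp : p.Prime) (hM : 0 < M) (hab : ¬ a ≡ b [MOD p]) :
    ((Finset.Ioo 0 p).filter fun q => q * a % p % M = q * b % p % M ∧
      q * b % p < q * a % p).card ≤ (p - 1) / M := by
  have hcard : (Finset.Icc 1 ((p - 1) / M)).card = (p - 1) / M := by simp
  rw [← hcard]
  have hlt (q c : ℕ) : q * c % p < p := Nat.mod_lt _ hp.pos
  -- For a bad `q` the difference of the two residues is a positive multiple of `M` below `p`. It
  -- determines `q`, since `a - b` is invertible modulo `p`.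
  refine Finset.card_le_card_of_injOn (fun q => (q * a % p - q * b % p) / M) ?_ ?_
  · intro q hq
    obtain ⟨-, h1, h2⟩ := Finset.mem_filter.1 hq
    have hd : M ∣ q * a % p - q * b % p := (Nat.modEq_iff_dvd' h2.le).1 (Eq.symm h1)
    refine Finset.mem_coe.2 (Finset.mem_Icc.2 ⟨?_, ?_⟩)
    · exact Nat.div_pos (Nat.le_of_dvd (by omega) hd) hM
    · exact Nat.div_le_div_right (by have := hlt q a; omega)
  · intro q hq q' hq' heq
    obtain ⟨hq0, h1, h2⟩ := Finset.mem_filter.1 hq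
    obtain ⟨hq0', h1', h2'⟩ := Finset.mem_filter.1 hq'
    have hd : M ∣ q * a % p - q * b % p := (Nat.modEq_iff_dvd' h2.le).1 (Eq.symm h1)
    have hd' : M ∣ q' * a % p - q' * b % p := (Nat.modEq_iff_dvd' h2'.le).1 (Eq.symm h1')
    have heq' : q * a % p - q * b % p = q' * a % p - q' * b % p := by
      rw [← Nat.div_mul_cancel hd, ← Nat.div_mul_cancel hd']
      exact congrArg (· * M) heq
    have hz : ((q : ℤ) - q') * (a - b) ≡ 0 [ZMOD p] := by
      have e1 (q c : ℕ) : ((q * c % p : ℕ) : ℤ) ≡ q * c [ZMOD p] := by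
        push_cast; exact Int.mod_modEq _ _
      have e2 : ((q * a % p : ℕ) : ℤ) - (q * b % p : ℕ) = (q' * a % p : ℕ) - (q' * b % p : ℕ) := by
        omega
      have e3 := (((e1 q a).sub (e1 q b)).symm.trans (by rw [e2])).trans
        ((e1 q' a).sub (e1 q' b))
      have e4 := e3.sub_right ((q' : ℤ) * a - q' * b)
      convert e4 using 1 <;> ring
    have hpz : Prime (p : ℤ) := Nat.prime_iff_prime_int.1 hp
    rcases hpz.dvd_or_dvd (Int.modEq_zero_iff_dvd.1 hz) with h | h
    · have := (Int.modEq_iff_dvd.2 (by simpa using h) : (q' : ℤ) ≡ q [ZMOD p])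
      have := (Int.natCast_modEq_iff.1 this).eq_of_lt_of_lt
        (Finset.mem_Ioo.1 hq0').2 (Finset.mem_Ioo.1 hq0).2
      exact this.symm
    · exact absurd (Int.natCast_modEq_iff.1 (Int.modEq_iff_dvd.2 h)).symm hab

/-- Union bound: at most `K ^ 2` ordered pairs each exclude at most `(p - 1) / (K ^ 2 + 1)` of the
`p - 1` nonzero multipliers. An ordered pair accounts only for the case in which its first residue
is the larger one. -/
theorem exists_multiplier_injOn {X : Finset ℕ} {K p : ℕ} (hX : X.card ≤ K) (hp : p.Prime)
    (hinj : Set.InjOn (fun x => x % p) (X : Set ℕ)) :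
    ∃ q < p, Set.InjOn (hashColor p q (K ^ 2 + 1)) (X : Set ℕ) := by
  classical
  by_contra! hno
  set B : ℕ × ℕ → Finset ℕ := fun z => (Finset.Ioo 0 p).filter fun q =>
    q * (z.1 % p) % p % (K ^ 2 + 1) = q * (z.2 % p) % p % (K ^ 2 + 1) ∧
      q * (z.2 % p) % p < q * (z.1 % p) % p with hB
  have hcov : Finset.Ioo 0 p ⊆ X.offDiag.biUnion B := by
    intro q hq
    obtain ⟨hq0, hqp⟩ := Finset.mem_Ioo.1 hq
    have h := hno q hqp
    simp only [Set.InjOn, not_forall] at h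
    obtain ⟨x, hx, y, hy, hxy, hne⟩ := h
    have hne' : q * (x % p) % p ≠ q * (y % p) % p := by
      intro h
      have h1 : x % p ≡ y % p [MOD p] :=
        Nat.ModEq.cancel_left_of_coprime
          ((hp.coprime_iff_not_dvd).2 (Nat.not_dvd_of_pos_of_lt hq0 hqp)) h
      exact hne (hinj hx hy (by simpa [Nat.ModEq] using h1))
    rw [Finset.mem_biUnion]
    rcases lt_or_gt_of_ne hne' with h | h
    · exact ⟨(y, x), Finset.mem_offDiag.2 ⟨hy, hx, Ne.symm hne⟩,
        Finset.mem_filter.2 ⟨hq, hxy.symm, h⟩⟩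
    · exact ⟨(x, y), Finset.mem_offDiag.2 ⟨hx, hy, hne⟩, Finset.mem_filter.2 ⟨hq, hxy, h⟩⟩
  have h1 := (Finset.card_le_card hcov).trans
    (Finset.card_biUnion_le_card_mul _ _ ((p - 1) / (K ^ 2 + 1)) fun z hz => by
      obtain ⟨hx, hy, hne⟩ := Finset.mem_offDiag.1 hz
      refine card_bad_multipliers_le hp (Nat.succ_pos _) fun h => hne (hinj hx hy ?_)
      simpa [Nat.ModEq] using h)
  rw [Nat.card_Ioo, Finset.offDiag_card] at h1
  have h2 : X.card * X.card ≤ K ^ 2 := by rw [sq]; exact Nat.mul_le_mul hX hX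
  have h3 : (p - 1) / (K ^ 2 + 1) * (K ^ 2 + 1) ≤ p - 1 := Nat.div_mul_le_self _ _
  have h4 : (X.card * X.card - X.card) * ((p - 1) / (K ^ 2 + 1)) ≤
      K ^ 2 * ((p - 1) / (K ^ 2 + 1)) := Nat.mul_le_mul_right _ (by omega)
  have h5 := hp.two_le
  have h6 := h1.trans h4
  rcases Nat.eq_zero_or_pos ((p - 1) / (K ^ 2 + 1)) with h0 | h0
  · rw [h0] at h6; omega
  · nlinarith [show p - 0 - 1 = p - 1 from rfl]

/-- Few numbers below `n` get different colours under some hash function, if `n` is large. -/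
theorem exists_hashColor_injOn {X : Finset ℕ} {K n : ℕ} (hX : X.card ≤ K) (hlt : ∀ x ∈ X, x < n)
    (hn : 4 ^ (K ^ 2 + 12) ≤ n) :
    ∃ p q, p < n ∧ q < p ∧ p * p ≤ n ∧
      Set.InjOn (hashColor p q (K ^ 2 + 1)) (X : Set ℕ) := by
  obtain ⟨p, hp, hpn, hinj⟩ := exists_prime_injOn_mod hX hlt hn
  obtain ⟨q, hq, hq'⟩ := exists_multiplier_injOn hX hp hinj
  exact ⟨p, q, by nlinarith [hp.two_le], hq, hpn, hq'⟩

/-! ### Building blocks of formulas -/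

section Formulas

variable {m n : ℕ}

/-- Terms with variables among the first `n` ones. -/
abbrev Tm (m n : ℕ) := (tauGraphC m).Term (Empty ⊕ Fin n)

/-- Formulas with free variables among the first `n` ones. -/
abbrev Fm (m n : ℕ) := (tauGraphC m).BoundedFormula Empty n

/-- The `i`-th variable. -/
def vr (i : Fin n) : Tm m n := Term.var (Sum.inr i)

/-- The constant symbol for `ℓ`. -/
def cst (ℓ : Fin m) : Tm m n :=
  Term.func (Sum.inr ℓ : (tauGraphC m).Functions 0) ![]

def eqF (s t : Tm m n) : Fm m n := .equal s t

def edgeF (s t : Tm m n) : Fm m n :=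
  .rel (Sum.inl GraphRel.edge : (tauGraphC m).Relations 2) ![s, t]

def ltF (s t : Tm m n) : Fm m n :=
  .rel (Sum.inl GraphRel.lt : (tauGraphC m).Relations 2) ![s, t]

def addF (s t u : Tm m n) : Fm m n :=
  .rel (Sum.inl GraphRel.add : (tauGraphC m).Relations 3) ![s, t, u]

def mulF (s t u : Tm m n) : Fm m n :=
  .rel (Sum.inl GraphRel.mul : (tauGraphC m).Relations 3) ![s, t, u]

def notF (f : Fm m n) : Fm m n := .imp f .falsum

def andF (f g : Fm m n) : Fm m n := notF (.imp f (notF g))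

def orF (f g : Fm m n) : Fm m n := .imp (notF f) g

def exF (f : Fm m (n + 1)) : Fm m n := notF (.all (notF f))

/-- The conjunction of `f 0, …, f (N - 1)`. -/
def bigAnd (N : ℕ) (f : ℕ → Fm m n) : Fm m n := N.rec (notF .falsum) fun l ih => andF ih (f l)

/-- The disjunction of `f 0, …, f (N - 1)`. -/
def bigOr (N : ℕ) (f : ℕ → Fm m n) : Fm m n := N.rec .falsum fun l ih => orF ih (f l)

end Formulas

/-! ### Quantifier rank -/

section Rank

variable {m n : ℕ}

@[simp] theorem quantifierRank_eqF (s t : Tm m n) : quantifierRank (eqF s t) = 0 := rfl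
@[simp] theorem quantifierRank_edgeF (s t : Tm m n) : quantifierRank (edgeF s t) = 0 := rfl
@[simp] theorem quantifierRank_ltF (s t : Tm m n) : quantifierRank (ltF s t) = 0 := rfl
@[simp] theorem quantifierRank_addF (s t u : Tm m n) : quantifierRank (addF s t u) = 0 := rfl
@[simp] theorem quantifierRank_mulF (s t u : Tm m n) : quantifierRank (mulF s t u) = 0 := rfl

@[simp] theorem quantifierRank_imp (f g : Fm m n) :
    quantifierRank (.imp f g) = max (quantifierRank f) (quantifierRank g) := rfl

@[simp] theorem quantifierRank_all (f : Fm m (n + 1)) :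
    quantifierRank (.all f) = 1 + quantifierRank f := rfl

@[simp] theorem quantifierRank_notF (f : Fm m n) :
    quantifierRank (notF f) = quantifierRank f := by
  simp [notF, quantifierRank]

@[simp] theorem quantifierRank_andF (f g : Fm m n) :
    quantifierRank (andF f g) = max (quantifierRank f) (quantifierRank g) := by
  simp [andF]

@[simp] theorem quantifierRank_orF (f g : Fm m n) :
    quantifierRank (orF f g) = max (quantifierRank f) (quantifierRank g) := by
  simp [orF]

@[simp] theorem quantifierRank_exF (f : Fm m (n + 1)) :
    quantifierRank (exF f) = 1 + quantifierRank f := by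
  simp [exF]

theorem quantifierRank_bigAnd_le {N r : ℕ} {f : ℕ → Fm m n} (h : ∀ l, quantifierRank (f l) ≤ r) :
    quantifierRank (bigAnd N f) ≤ r := by
  induction N with
  | zero => exact Nat.zero_le r
  | succ N ih => exact (quantifierRank_andF _ _).trans_le (max_le ih (h N))

theorem quantifierRank_bigOr_le {N r : ℕ} {f : ℕ → Fm m n} (h : ∀ l, quantifierRank (f l) ≤ r) :
    quantifierRank (bigOr N f) ≤ r := by
  induction N with
  | zero => exact Nat.zero_le r
  | succ N ih => exact (quantifierRank_orF _ _).trans_le (max_le ih (h N))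

end Rank

/-! ### Satisfaction -/

section Semantics

variable {V : Type u} [tauGraph.Structure V] {m n : ℕ} (κ : Fin m → V)

/-- Satisfaction of a formula, with constants interpreted by `κ` and variables by `s`. -/
def Sat (f : Fm m n) (s : ℕ → V) : Prop :=
  letI : (constantsOn (Fin m)).Structure V := constantsOn.structure κ
  f.Realize (default : Empty → V) fun i : Fin n => s i

/-- The value of a term, with constants interpreted by `κ` and variables by `s`. -/
def tmVal (s : ℕ → V) (t : Tm m n) : V :=
  letI : (constantsOn (Fin m)).Structure V := constantsOn.structure κ
  t.realize (Sum.elim (default : Empty → V) fun i : Fin n => s i)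

variable {κ} {s : ℕ → V}

@[simp] theorem tmVal_vr (i : Fin n) : tmVal κ s (vr i) = s i := rfl

@[simp] theorem tmVal_cst (ℓ : Fin m) : tmVal κ s (cst ℓ : Tm m n) = κ ℓ := rfl

@[simp] theorem sat_eqF (t₁ t₂ : Tm m n) : Sat κ (eqF t₁ t₂) s ↔ tmVal κ s t₁ = tmVal κ s t₂ :=
  Iff.rfl

theorem sat_rel₂ (R : GraphRel 2) (t₁ t₂ : Tm m n) :
    Sat κ (.rel (Sum.inl R : (tauGraphC m).Relations 2) ![t₁, t₂]) s ↔
      Structure.RelMap (L := tauGraph) (R : tauGraph.Relations 2)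
        ![tmVal κ s t₁, tmVal κ s t₂] := by
  refine iff_of_eq (congrArg (Structure.RelMap (L := tauGraph) (R : tauGraph.Relations 2))
    (funext fun i => ?_))
  fin_cases i <;> rfl

theorem sat_rel₃ (R : GraphRel 3) (t₁ t₂ t₃ : Tm m n) :
    Sat κ (.rel (Sum.inl R : (tauGraphC m).Relations 3) ![t₁, t₂, t₃]) s ↔
      Structure.RelMap (L := tauGraph) (R : tauGraph.Relations 3)
        ![tmVal κ s t₁, tmVal κ s t₂, tmVal κ s t₃] := by
  refine iff_of_eq (congrArg (Structure.RelMap (L := tauGraph) (R : tauGraph.Relations 3))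
    (funext fun i => ?_))
  fin_cases i <;> rfl

@[simp] theorem sat_edgeF (t₁ t₂ : Tm m n) :
    Sat κ (edgeF t₁ t₂) s ↔ Edge (tmVal κ s t₁) (tmVal κ s t₂) := sat_rel₂ _ _ _

@[simp] theorem sat_ltF (t₁ t₂ : Tm m n) :
    Sat κ (ltF t₁ t₂) s ↔ LtRel (tmVal κ s t₁) (tmVal κ s t₂) := sat_rel₂ _ _ _

@[simp] theorem sat_addF (t₁ t₂ t₃ : Tm m n) :
    Sat κ (addF t₁ t₂ t₃) s ↔ AddRel (tmVal κ s t₁) (tmVal κ s t₂) (tmVal κ s t₃) :=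
  sat_rel₃ _ _ _ _

@[simp] theorem sat_mulF (t₁ t₂ t₃ : Tm m n) :
    Sat κ (mulF t₁ t₂ t₃) s ↔ MulRel (tmVal κ s t₁) (tmVal κ s t₂) (tmVal κ s t₃) :=
  sat_rel₃ _ _ _ _

@[simp] theorem sat_imp (f g : Fm m n) : Sat κ (.imp f g) s ↔ (Sat κ f s → Sat κ g s) := Iff.rfl

@[simp] theorem sat_notF (f : Fm m n) : Sat κ (notF f) s ↔ ¬ Sat κ f s := Iff.rfl

@[simp] theorem sat_andF (f g : Fm m n) : Sat κ (andF f g) s ↔ Sat κ f s ∧ Sat κ g s := by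
  simp [andF]

@[simp] theorem sat_orF (f g : Fm m n) : Sat κ (orF f g) s ↔ Sat κ f s ∨ Sat κ g s := by
  simp [orF, or_iff_not_imp_left]

/-- Assignments are infinite sequences, so that binding the variable `n` becomes an update at `n`.
-/
theorem snoc_eq_update {V : Type*} (s : ℕ → V) (n : ℕ) (a : V) :
    (Fin.snoc (fun i : Fin n => s i) a : Fin (n + 1) → V) =
      fun i : Fin (n + 1) => Function.update s n a i := by
  funext i
  refine Fin.lastCases ?_ (fun j => ?_) i
  · simp
  · simp [Function.update_of_ne j.isLt.ne]

@[simp] theorem sat_all (f : Fm m (n + 1)) :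
    Sat κ (.all f) s ↔ ∀ a, Sat κ f (Function.update s n a) := by
  refine forall_congr' fun a => ?_
  rw [snoc_eq_update]
  rfl

@[simp] theorem sat_exF (f : Fm m (n + 1)) :
    Sat κ (exF f) s ↔ ∃ a, Sat κ f (Function.update s n a) := by
  simp [exF]

@[simp] theorem sat_bigAnd (N : ℕ) (f : ℕ → Fm m n) :
    Sat κ (bigAnd N f) s ↔ ∀ l < N, Sat κ (f l) s := by
  induction N with
  | zero => simp only [Nat.not_lt_zero, false_imp_iff, implies_true, iff_true]; exact id
  | succ N ih =>
    refine (sat_andF _ _).trans ?_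
    rw [Nat.forall_lt_succ_right]
    exact and_congr ih Iff.rfl

@[simp] theorem sat_bigOr (N : ℕ) (f : ℕ → Fm m n) :
    Sat κ (bigOr N f) s ↔ ∃ l < N, Sat κ (f l) s := by
  induction N with
  | zero => simp only [Nat.not_lt_zero, false_and, exists_false, iff_false]; exact id
  | succ N ih =>
    refine (sat_orF _ _).trans ?_
    rw [Nat.exists_lt_succ_right]
    exact or_congr ih Iff.rfl

theorem ArithIso.models_iff_sat [Nonempty V] {N : ℕ} (e : ArithIso V N)
    (f : (tauGraphC m).Sentence) (s : ℕ → V) :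
    e.Models f ↔ Sat (n := 0) (fun ℓ : Fin m => e.const ℓ) f s := by
  refine iff_of_eq (congrArg₂ (fun v xs =>
    letI : (constantsOn (Fin m)).Structure V := constantsOn.structure fun ℓ : Fin m => e.const ℓ
    BoundedFormula.Realize (L := tauGraphC m) (l := 0) f v xs) ?_ ?_)
  · rfl
  · exact Subsingleton.elim _ _

end Semantics

/-! ### The sentences -/

section Sentences

variable {m : ℕ}

/-- `E` is the edge relation of a simple graph. -/
def graphF : Fm m 0 :=
  andF (.all (notF (edgeF (vr 0) (vr 0))))
    (.all (.all (.imp (edgeF (vr 0) (vr 1)) (edgeF (vr 1) (vr 0)))))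

/-- The matrix of `colorF`. -/
def colorBody (cM ci : Fin m) (z : Fin 14) : Fm m 14 :=
  -- Two divisions by `p` and one by `M`: `z = p * v6 + v5`, `q * v5 = v8 = p * v9 + v11` and `v11 =
  -- M * v12 + i`. Variables `2`, `3` and `4` are kept for the ends of an edge and a neighbour.
  andF (mulF (vr 0) (vr 6) (vr 7)) <|
  andF (addF (vr 7) (vr 5) (vr z)) <|
  andF (ltF (vr 5) (vr 0)) <|
  andF (mulF (vr 1) (vr 5) (vr 8)) <|
  andF (mulF (vr 0) (vr 9) (vr 10)) <|
  andF (addF (vr 10) (vr 11) (vr 8)) <|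
  andF (ltF (vr 11) (vr 0)) <|
  andF (mulF (cst cM) (vr 12) (vr 13)) (addF (vr 13) (cst ci) (vr 11))

/-- The variable `z` has the colour `ci` under the hash function whose parameters are the
variables `0` and `1` and whose number of colours is `cM`. -/
def colorF (cM ci : Fin m) (z : Fin 5) : Fm m 5 :=
  exF <| exF <| exF <| exF <| exF <| exF <| exF <| exF <| exF <|
    colorBody cM ci (Fin.castLE (by decide) z)

/-- The variable `z` has the colour `ci` and a neighbour of the colour `cj`. -/
def colorEdgeF (cM ci cj : Fin m) (z : Fin 4) : Fm m 4 :=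
  exF <| andF (edgeF (vr z.castSucc) (vr 4)) <|
    andF (colorF cM ci z.castSucc) (colorF cM cj 4)

/-- Each of the formulas `C 0, …, C (k - 1)` defines at most one vertex, and the vertices
defined by them form a vertex cover. -/
def coverF (k : ℕ) (C : ℕ → Fin 4 → Fm m 4) : Fm m 2 :=
  -- The same two variables serve for uniqueness and for covering; `k` only lengthens the Boolean
  -- combinations.
  .all <| .all <| andF
    (bigAnd k fun l => .imp (C l 2) (.imp (C l 3) (eqF (vr 2) (vr 3))))
    (.imp (edgeF (vr 2) (vr 3)) (bigOr k fun l => orF (C l 2) (C l 3)))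

/-- The constant symbols for `0, …, k - 1` have distinct values. -/
def sizeF (H k : ℕ) : Fm (H + 1) 0 :=
  -- Comparing consecutive constants suffices: those from `n - 1` on all denote the last element, so
  -- this says `k ≤ n`.
  bigAnd (k - 1) fun l => notF (eqF (cst (Fin.ofNat (H + 1) l)) (cst (Fin.ofNat (H + 1) (l + 1))))

/-- The digit at the place `l` of `t` in base `B`. -/
def digit (B t l : ℕ) : ℕ := t / B ^ l % B

/-- Some `k` of the elements `0, …, N - 1` form a vertex cover. -/
def smallCoverF (H N k : ℕ) : Fm (H + 1) 2 :=
  bigOr (N ^ k) fun t => coverF k fun l z => eqF (vr z) (cst (Fin.ofNat (H + 1) (digit N t l)))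

/-- For some list of `k` pairs of colours below `M`, the vertices of the first colour with a
neighbour of the second colour form a vertex cover. -/
def colorCoverF (H M k : ℕ) : Fm (H + 1) 2 :=
  bigOr ((M * M) ^ k) fun t => coverF k fun l z =>
    colorEdgeF (Fin.ofNat (H + 1) M) (Fin.ofNat (H + 1) (digit (M * M) t l / M))
      (Fin.ofNat (H + 1) (digit (M * M) t l % M)) z

/-- The graph has a vertex cover of size `k`. -/
def vertexCoverF (H N M k : ℕ) : Fm (H + 1) 0 :=
  andF graphF <| andF (sizeF H k) <| exF <| exF <|
    orF (smallCoverF H N k) (colorCoverF H M k)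

end Sentences

/-! ### Their quantifier rank -/

section Rank

variable {m : ℕ}

theorem quantifierRank_colorEdgeF (cM ci cj : Fin m) (z : Fin 4) :
    quantifierRank (colorEdgeF cM ci cj z) = 10 := by
  simp [colorEdgeF, colorF, colorBody]

theorem quantifierRank_coverF_le {k r : ℕ} {C : ℕ → Fin 4 → Fm m 4}
    (h : ∀ l z, quantifierRank (C l z) ≤ r) : quantifierRank (coverF k C) ≤ 2 + r := by
  have h1 : quantifierRank (bigAnd k fun l => .imp (C l 2) (.imp (C l 3) (eqF (vr 2) (vr 3)))) ≤
      r := quantifierRank_bigAnd_le fun l => by simp [h]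
  have h2 : quantifierRank (bigOr k fun l => orF (C l 2) (C l 3)) ≤ r :=
    quantifierRank_bigOr_le fun l => by simp [h]
  simp only [coverF, quantifierRank_all, quantifierRank_andF, quantifierRank_imp,
    quantifierRank_edgeF]
  omega

/-- The count is in fact 14: two for `p`, `q`, two for an edge, one for a neighbour and nine for the
divisions. -/
theorem quantifierRank_vertexCoverF_le (H N M k : ℕ) :
    quantifierRank (vertexCoverF H N M k) ≤ 16 := by
  have h1 : quantifierRank (sizeF H k) ≤ 0 := quantifierRank_bigAnd_le fun l => by simp
  have h2 : quantifierRank (smallCoverF H N k) ≤ 2 + 0 :=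
    quantifierRank_bigOr_le fun t => quantifierRank_coverF_le fun l z => by simp
  have h3 : quantifierRank (colorCoverF H M k) ≤ 2 + 10 :=
    quantifierRank_bigOr_le fun t => quantifierRank_coverF_le fun l z =>
      (quantifierRank_colorEdgeF _ _ _ _).le
  simp only [vertexCoverF, graphF, quantifierRank_all, quantifierRank_andF, quantifierRank_orF,
    quantifierRank_exF, quantifierRank_imp, quantifierRank_edgeF, quantifierRank_notF]
  omega

end Rank

/-! ### Their meaning -/

section Semantics

variable {V : Type u} [tauGraph.Structure V] {m : ℕ} {κ : Fin m → V} {s : ℕ → V}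

theorem sat_graphF : Sat κ graphF s ↔ (∀ a : V, ¬ Edge a a) ∧ ∀ a b : V, Edge a b → Edge b a := by
  simp [graphF]

/-- The relation defined by `colorF`. -/
def ColorRel (p q cM ci z : V) : Prop :=
  ∃ r s a b u d w t e : V, MulRel p s a ∧ AddRel a r z ∧ LtRel r p ∧ MulRel q r b ∧
    MulRel p u d ∧ AddRel d w b ∧ LtRel w p ∧ MulRel cM t e ∧ AddRel e ci w

theorem sat_colorF (cM ci : Fin m) (z : Fin 5) :
    Sat κ (colorF cM ci z) s ↔ ColorRel (s 0) (s 1) (κ cM) (κ ci) (s z) := by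
  have hz (a : ℕ) (ha : 5 ≤ a) : (z : ℕ) ≠ a := by omega
  simp [colorF, colorBody, ColorRel, hz]

theorem sat_colorEdgeF (cM ci cj : Fin m) (z : Fin 4) :
    Sat κ (colorEdgeF cM ci cj z) s ↔ ∃ y, Edge (s z) y ∧
      ColorRel (s 0) (s 1) (κ cM) (κ ci) (s z) ∧ ColorRel (s 0) (s 1) (κ cM) (κ cj) y := by
  have hz : (z : ℕ) ≠ 4 := by omega
  simp [colorEdgeF, sat_colorF, hz]

theorem sat_coverF {k : ℕ} {C : ℕ → Fin 4 → Fm m 4} {D : ℕ → V → Prop}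
    (hC : ∀ l (z : Fin 4) (s' : ℕ → V), s' 0 = s 0 → s' 1 = s 1 → (Sat κ (C l z) s' ↔ D l (s' z))) :
    Sat κ (coverF k C) s ↔ (∀ l < k, ∀ a b, D l a → D l b → a = b) ∧
      ∀ a b : V, Edge a b → ∃ l < k, D l a ∨ D l b := by
  simp only [coverF, sat_all, sat_andF, sat_bigAnd, sat_imp, sat_bigOr, sat_orF]
  simp [hC]
  grind

end Semantics

/-! ### Computability of the sentences -/

section Computability

theorem primrec_pow : Primrec₂ fun a b : ℕ => a ^ b := by
  have h : Primrec₂ fun (p : ℕ × ℕ) (q : ℕ × ℕ) => q.2 * p.1 :=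
    Primrec.nat_mul.comp (Primrec.snd.comp Primrec.snd) (Primrec.fst.comp Primrec.fst)
  refine (Primrec.nat_rec' Primrec.snd (Primrec.const 1) h).of_eq fun p => ?_
  obtain ⟨a, b⟩ := p
  induction b with
  | zero => rfl
  | succ b ih => exact (congrArg (· * a) ih).trans (pow_succ a b).symm

variable {α : Type*} [Primcodable α]

theorem primrec_digit {B t l : α → ℕ} (hB : Primrec B) (ht : Primrec t) (hl : Primrec l) :
    Primrec fun a => digit (B a) (t a) (l a) :=
  Primrec.nat_mod.comp (Primrec.nat_div.comp ht (primrec_pow.comp hB hl)) hB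

variable {n : ℕ} {m : α → ℕ}

/-- A family of terms with a primitive recursive code. -/
def PrimTm (t : ∀ a, Tm (m a) n) : Prop := Primrec fun a => termCode (t a)

/-- A family of formulas with a primitive recursive code. -/
def PrimFm (f : ∀ a, Fm (m a) n) : Prop := Primrec fun a => formulaCode (f a)

theorem primTm_vr (i : Fin n) : PrimTm fun a => (vr i : Tm (m a) n) := Primrec.const (2 * (i : ℕ))

theorem primTm_cst {H ℓ : α → ℕ} (hH : Primrec H) (hℓ : Primrec ℓ) :
    PrimTm fun a => (cst (Fin.ofNat (H a + 1) (ℓ a)) : Tm (H a + 1) n) :=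
  Primrec.succ.comp (Primrec.nat_mul.comp (Primrec.const 2)
    (Primrec.nat_mod.comp hℓ (Primrec.succ.comp hH)))

theorem primrec_four_mul_add {f : α → ℕ} (hf : Primrec f) (c : ℕ) :
    Primrec fun a => 4 * f a + c :=
  Primrec.nat_add.comp (Primrec.nat_mul.comp (Primrec.const 4) hf) (Primrec.const c)

theorem primFm_eqF {s t : ∀ a, Tm (m a) n} (hs : PrimTm s) (ht : PrimTm t) :
    PrimFm fun a => eqF (s a) (t a) :=
  primrec_four_mul_add (Primrec₂.natPair.comp hs ht) 1

theorem primrec_relCode₂ {s t : ∀ a, Tm (m a) n} (hs : PrimTm s) (ht : PrimTm t) (c : ℕ) :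
    Primrec fun a => 4 * Nat.pair c (Encodable.encode [termCode (s a), termCode (t a)]) + 2 :=
  primrec_four_mul_add (Primrec₂.natPair.comp (Primrec.const c) (Primrec.encode.comp
    (Primrec.list_cons.comp hs (Primrec.list_cons.comp ht (Primrec.const []))))) 2

theorem primrec_relCode₃ {s t u : ∀ a, Tm (m a) n} (hs : PrimTm s) (ht : PrimTm t)
    (hu : PrimTm u) (c : ℕ) :
    Primrec fun a => 4 * Nat.pair c
      (Encodable.encode [termCode (s a), termCode (t a), termCode (u a)]) + 2 :=
  primrec_four_mul_add (Primrec₂.natPair.comp (Primrec.const c) (Primrec.encode.comp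
    (Primrec.list_cons.comp hs (Primrec.list_cons.comp ht
      (Primrec.list_cons.comp hu (Primrec.const [])))))) 2

theorem primFm_edgeF {s t : ∀ a, Tm (m a) n} (hs : PrimTm s) (ht : PrimTm t) :
    PrimFm fun a => edgeF (s a) (t a) :=
  (primrec_relCode₂ hs ht 0).of_eq fun _ => rfl

theorem primFm_ltF {s t : ∀ a, Tm (m a) n} (hs : PrimTm s) (ht : PrimTm t) :
    PrimFm fun a => ltF (s a) (t a) :=
  (primrec_relCode₂ hs ht 1).of_eq fun _ => rfl

theorem primFm_addF {s t u : ∀ a, Tm (m a) n} (hs : PrimTm s) (ht : PrimTm t) (hu : PrimTm u) :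
    PrimFm fun a => addF (s a) (t a) (u a) :=
  (primrec_relCode₃ hs ht hu 2).of_eq fun _ => rfl

theorem primFm_mulF {s t u : ∀ a, Tm (m a) n} (hs : PrimTm s) (ht : PrimTm t) (hu : PrimTm u) :
    PrimFm fun a => mulF (s a) (t a) (u a) :=
  (primrec_relCode₃ hs ht hu 3).of_eq fun _ => rfl

theorem primFm_falsum : PrimFm fun a => (.falsum : Fm (m a) n) := Primrec.const 0

theorem primFm_imp {f g : ∀ a, Fm (m a) n} (hf : PrimFm f) (hg : PrimFm g) :
    PrimFm fun a => (f a).imp (g a) :=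
  primrec_four_mul_add (Primrec₂.natPair.comp hf hg) 3

theorem primFm_all {f : ∀ a, Fm (m a) (n + 1)} (hf : PrimFm f) : PrimFm fun a => (f a).all :=
  primrec_four_mul_add hf 4

theorem primFm_notF {f : ∀ a, Fm (m a) n} (hf : PrimFm f) : PrimFm fun a => notF (f a) :=
  primFm_imp hf primFm_falsum

theorem primFm_andF {f g : ∀ a, Fm (m a) n} (hf : PrimFm f) (hg : PrimFm g) :
    PrimFm fun a => andF (f a) (g a) :=
  primFm_notF (primFm_imp hf (primFm_notF hg))

theorem primFm_orF {f g : ∀ a, Fm (m a) n} (hf : PrimFm f) (hg : PrimFm g) :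
    PrimFm fun a => orF (f a) (g a) :=
  primFm_imp (primFm_notF hf) hg

theorem primFm_exF {f : ∀ a, Fm (m a) (n + 1)} (hf : PrimFm f) : PrimFm fun a => exF (f a) :=
  primFm_notF (primFm_all (primFm_notF hf))

theorem primFm_bigAnd {N : α → ℕ} {f : ∀ a, ℕ → Fm (m a) n} (hN : Primrec N)
    (hf : PrimFm fun p : α × ℕ => f p.1 p.2) : PrimFm fun a => bigAnd (N a) (f a) := by
  -- The recursion step on codes: `andF g f` unfolds to `(g → (f → ⊥)) → ⊥`, where `p.2` is the code
  -- of `g` and `0` that of `⊥`.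
  have hc : Primrec₂ fun (a : α) (p : ℕ × ℕ) =>
      4 * Nat.pair (4 * Nat.pair p.2 (4 * Nat.pair (formulaCode (f a p.1)) 0 + 3) + 3) 0 + 3 := by
    have h1 : Primrec fun q : α × ℕ × ℕ => formulaCode (f q.1 q.2.1) :=
      Primrec.comp hf (Primrec.pair Primrec.fst (Primrec.fst.comp Primrec.snd))
    exact primrec_four_mul_add (Primrec₂.natPair.comp (primrec_four_mul_add (Primrec₂.natPair.comp
      (Primrec.snd.comp Primrec.snd) (primrec_four_mul_add (Primrec₂.natPair.comp h1
        (Primrec.const 0)) 3)) 3) (Primrec.const 0)) 3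
  refine (Primrec.nat_rec' hN (Primrec.const (4 * Nat.pair 0 0 + 3)) hc).of_eq fun a => ?_
  change _ = formulaCode (bigAnd (N a) (f a))
  generalize N a = K
  induction K with
  | zero => rfl
  | succ K ih =>
    change 4 * Nat.pair (4 * Nat.pair _ _ + 3) 0 + 3 = _
    rw [ih]
    rfl

theorem primFm_bigOr {N : α → ℕ} {f : ∀ a, ℕ → Fm (m a) n} (hN : Primrec N)
    (hf : PrimFm fun p : α × ℕ => f p.1 p.2) : PrimFm fun a => bigOr (N a) (f a) := by
  have hc : Primrec₂ fun (a : α) (p : ℕ × ℕ) =>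
      4 * Nat.pair (4 * Nat.pair p.2 0 + 3) (formulaCode (f a p.1)) + 3 := by
    have h1 : Primrec fun q : α × ℕ × ℕ => formulaCode (f q.1 q.2.1) :=
      Primrec.comp hf (Primrec.pair Primrec.fst (Primrec.fst.comp Primrec.snd))
    exact primrec_four_mul_add (Primrec₂.natPair.comp (primrec_four_mul_add (Primrec₂.natPair.comp
      (Primrec.snd.comp Primrec.snd) (Primrec.const 0)) 3) h1) 3
  refine (Primrec.nat_rec' hN (Primrec.const 0) hc).of_eq fun a => ?_
  change _ = formulaCode (bigOr (N a) (f a))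
  generalize N a = K
  induction K with
  | zero => rfl
  | succ K ih =>
    change 4 * Nat.pair (4 * Nat.pair _ _ + 3) _ + 3 = _
    rw [ih]
    rfl

theorem primFm_graphF : PrimFm fun a => (graphF : Fm (m a) 0) :=
  primFm_andF (primFm_all (primFm_notF (primFm_edgeF (primTm_vr _) (primTm_vr _))))
    (primFm_all (primFm_all (primFm_imp (primFm_edgeF (primTm_vr _) (primTm_vr _))
      (primFm_edgeF (primTm_vr _) (primTm_vr _)))))

variable {H : α → ℕ}

theorem primFm_colorF {M i : α → ℕ} (hH : Primrec H) (hM : Primrec M) (hi : Primrec i)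
    (z : Fin 5) :
    PrimFm fun a => colorF (Fin.ofNat (H a + 1) (M a)) (Fin.ofNat (H a + 1) (i a)) z := by
  refine primFm_exF <| primFm_exF <| primFm_exF <| primFm_exF <| primFm_exF <| primFm_exF <|
    primFm_exF <| primFm_exF <| primFm_exF ?_
  have v (j : Fin 14) : PrimTm fun a => (vr j : Tm (H a + 1) 14) := primTm_vr j
  exact primFm_andF (primFm_mulF (v _) (v _) (v _)) <|
    primFm_andF (primFm_addF (v _) (v _) (v _)) <|
    primFm_andF (primFm_ltF (v _) (v _)) <|
    primFm_andF (primFm_mulF (v _) (v _) (v _)) <|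
    primFm_andF (primFm_mulF (v _) (v _) (v _)) <|
    primFm_andF (primFm_addF (v _) (v _) (v _)) <|
    primFm_andF (primFm_ltF (v _) (v _)) <|
    primFm_andF (primFm_mulF (primTm_cst hH hM) (v _) (v _))
      (primFm_addF (v _) (primTm_cst hH hi) (v _))

theorem primFm_colorEdgeF {M i j : α → ℕ} (hH : Primrec H) (hM : Primrec M) (hi : Primrec i)
    (hj : Primrec j) (z : Fin 4) :
    PrimFm fun a => colorEdgeF (Fin.ofNat (H a + 1) (M a)) (Fin.ofNat (H a + 1) (i a))
      (Fin.ofNat (H a + 1) (j a)) z :=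
  primFm_exF <| primFm_andF (primFm_edgeF (primTm_vr _) (primTm_vr _)) <|
    primFm_andF (primFm_colorF hH hM hi _) (primFm_colorF hH hM hj _)

theorem primFm_coverF {k : α → ℕ} {C : ∀ a, ℕ → Fin 4 → Fm (m a) 4} (hk : Primrec k)
    (hC : ∀ z, PrimFm fun p : α × ℕ => C p.1 p.2 z) : PrimFm fun a => coverF (k a) (C a) :=
  primFm_all <| primFm_all <| primFm_andF
    (primFm_bigAnd hk (primFm_imp (hC 2) (primFm_imp (hC 3)
      (primFm_eqF (primTm_vr _) (primTm_vr _)))))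
    (primFm_imp (primFm_edgeF (primTm_vr _) (primTm_vr _))
      (primFm_bigOr hk (primFm_orF (hC 2) (hC 3))))

theorem primFm_sizeF {k : α → ℕ} (hH : Primrec H) (hk : Primrec k) :
    PrimFm fun a => sizeF (H a) (k a) :=
  primFm_bigAnd (Primrec.nat_sub.comp hk (Primrec.const 1)) <| primFm_notF <| primFm_eqF
    (primTm_cst (hH.comp Primrec.fst) Primrec.snd)
    (primTm_cst (hH.comp Primrec.fst) (Primrec.succ.comp Primrec.snd))

theorem primFm_smallCoverF {N k : α → ℕ} (hH : Primrec H) (hN : Primrec N) (hk : Primrec k) :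
    PrimFm fun a => smallCoverF (H a) (N a) (k a) :=
  primFm_bigOr (primrec_pow.comp hN hk) <| primFm_coverF (hk.comp Primrec.fst) fun _ =>
    primFm_eqF (primTm_vr _) <| primTm_cst ((hH.comp Primrec.fst).comp Primrec.fst) <|
      primrec_digit ((hN.comp Primrec.fst).comp Primrec.fst) (Primrec.snd.comp Primrec.fst)
        Primrec.snd

theorem primFm_colorCoverF {M k : α → ℕ} (hH : Primrec H) (hM : Primrec M) (hk : Primrec k) :
    PrimFm fun a => colorCoverF (H a) (M a) (k a) := by
  have hMM : Primrec fun a => M a * M a := Primrec.nat_mul.comp hM hM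
  have hM' : Primrec fun p : (α × ℕ) × ℕ => M p.1.1 := (hM.comp Primrec.fst).comp Primrec.fst
  have hd : Primrec fun p : (α × ℕ) × ℕ => digit (M p.1.1 * M p.1.1) p.1.2 p.2 :=
    primrec_digit ((hMM.comp Primrec.fst).comp Primrec.fst) (Primrec.snd.comp Primrec.fst)
      Primrec.snd
  exact primFm_bigOr (primrec_pow.comp hMM hk) <| primFm_coverF (hk.comp Primrec.fst) fun z =>
    primFm_colorEdgeF ((hH.comp Primrec.fst).comp Primrec.fst) hM'
      (Primrec.nat_div.comp hd hM') (Primrec.nat_mod.comp hd hM') z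

theorem primFm_vertexCoverF {N M k : α → ℕ} (hH : Primrec H) (hN : Primrec N) (hM : Primrec M)
    (hk : Primrec k) : PrimFm fun a => vertexCoverF (H a) (N a) (M a) (k a) :=
  primFm_andF primFm_graphF <| primFm_andF (primFm_sizeF hH hk) <| primFm_exF <| primFm_exF <|
    primFm_orF (primFm_smallCoverF hH hN hk) (primFm_colorCoverF hH hM hk)

end Computability

/-! ### Correctness -/

section Correctness

variable {V : Type u} [tauGraph.Structure V] {n : ℕ}

/-- The number corresponding to an element. -/
def ArithIso.val (e : ArithIso V n) (x : V) : ℕ := e.toEquiv x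

theorem ArithIso.val_lt (e : ArithIso V n) (x : V) : e.val x < n := (e.toEquiv x).isLt

theorem ArithIso.val_injective (e : ArithIso V n) : Function.Injective e.val :=
  Fin.val_injective.comp e.toEquiv.injective

theorem ArithIso.exists_val_eq (e : ArithIso V n) {j : ℕ} (hj : j < n) : ∃ x, e.val x = j :=
  ⟨e.toEquiv.symm ⟨j, hj⟩, by simp [ArithIso.val]⟩

theorem ArithIso.val_const [Nonempty V] (e : ArithIso V n) (ℓ : ℕ) :
    e.val (e.const ℓ) = if ℓ < n then ℓ else n - 1 :=
  congrArg Fin.val (e.toEquiv.apply_symm_apply _)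

theorem ArithIso.val_const_of_lt [Nonempty V] (e : ArithIso V n) {ℓ : ℕ} (h : ℓ < n) :
    e.val (e.const ℓ) = ℓ := by
  rw [e.val_const, if_pos h]

theorem ArithIso.const_ofNat [Nonempty V] (e : ArithIso V n) {H ℓ : ℕ} (h : ℓ ≤ H) :
    e.const (Fin.ofNat (H + 1) ℓ : Fin (H + 1)) = e.const ℓ := by
  rw [Fin.val_ofNat, Nat.mod_eq_of_lt (Nat.lt_succ_of_le h)]

/-- The largest intermediate value is `q * (z % p) < p * p ≤ n`, so every witness exists in the
universe. The conditions `w < p` and `i < M` make the quotients and remainders the true ones. -/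
theorem ArithIso.colorRel_iff (e : ArithIso V n) {p q cM ci z : V} {M i : ℕ}
    (hpn : e.val p * e.val p ≤ n) (hq : e.val q < e.val p) (hM : e.val cM = M) (hi : e.val ci = i)
    (hiM : i < M) :
    ColorRel p q cM ci z ↔ hashColor (e.val p) (e.val q) M (e.val z) = i := by
  have hlt (a b : V) : LtRel a b ↔ e.val a < e.val b := e.map_lt a b
  have hadd (a b c : V) : AddRel a b c ↔ e.val c = e.val a + e.val b := e.map_add a b c
  have hmul (a b c : V) : MulRel a b c ↔ e.val c = e.val a * e.val b := e.map_mul a b c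
  simp only [ColorRel, hlt, hadd, hmul, hM, hi, hashColor]
  constructor
  · rintro ⟨r, s, a, b, u, d, w, t, c, h1, h2, h3, h4, h5, h6, h7, h8, h9⟩
    have hr : e.val z % e.val p = e.val r := by
      rw [h2, h1, Nat.mul_add_mod, Nat.mod_eq_of_lt h3]
    rw [hr, ← h4, h6, h5, Nat.mul_add_mod, Nat.mod_eq_of_lt h7, h9, h8, Nat.mul_add_mod,
      Nat.mod_eq_of_lt hiM]
  · intro h
    have hp0 : 0 < e.val p := by omega
    have hz := e.val_lt z
    have hzp := Nat.mod_lt (e.val z) hp0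
    have hb : e.val q * (e.val z % e.val p) < n :=
      (Nat.mul_lt_mul'' hq hzp).trans_le hpn
    have hd := Nat.div_add_mod (e.val q * (e.val z % e.val p)) (e.val p)
    have hw := Nat.mod_lt (e.val q * (e.val z % e.val p)) hp0
    have hc := Nat.div_add_mod (e.val q * (e.val z % e.val p) % e.val p) M
    obtain ⟨r, hr⟩ := e.exists_val_eq ((Nat.mod_le (e.val z) (e.val p)).trans_lt hz)
    obtain ⟨s, hs⟩ := e.exists_val_eq ((Nat.div_le_self (e.val z) (e.val p)).trans_lt hz)
    obtain ⟨a, ha⟩ := e.exists_val_eq ((Nat.mul_div_le (e.val z) (e.val p)).trans_lt hz)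
    obtain ⟨b, hb'⟩ := e.exists_val_eq hb
    obtain ⟨u, hu⟩ := e.exists_val_eq ((Nat.div_le_self _ (e.val p)).trans_lt hb)
    obtain ⟨d, hd'⟩ := e.exists_val_eq ((Nat.mul_div_le _ (e.val p)).trans_lt hb)
    have hwn := (Nat.mod_le _ (e.val p)).trans_lt hb
    obtain ⟨w, hw'⟩ := e.exists_val_eq hwn
    obtain ⟨t, ht⟩ := e.exists_val_eq ((Nat.div_le_self _ M).trans_lt hwn)
    obtain ⟨c, hc'⟩ := e.exists_val_eq ((Nat.mul_div_le _ M).trans_lt hwn)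
    refine ⟨r, s, a, b, u, d, w, t, c, ?_, ?_, ?_, ?_, ?_, ?_, ?_, ?_, ?_⟩
    · rw [ha, hs]
    · rw [ha, hr, Nat.div_add_mod]
    · rwa [hr]
    · rw [hb', hr]
    · rw [hd', hu]
    · rw [hb', hd', hw', hd]
    · rwa [hw']
    · rw [hc', ht]
    · rw [hw', hc', ← h, hc]

/-! ### Lists of definable vertices and minimal covers -/

theorem exists_digit_eq {B k : ℕ} {f : ℕ → ℕ} (hf : ∀ l < k, f l < B) :
    ∃ t < B ^ k, ∀ l < k, digit B t l = f l := by
  obtain ⟨t, ht⟩ := finFunctionFinEquiv.symm.surjective fun l : Fin k => (⟨f l, hf l l.2⟩ : Fin B)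
  exact ⟨t, t.2, fun l hl => congrArg Fin.val (congrFun ht ⟨l, hl⟩)⟩

/-- The sets defined by `D 0, …, D (k - 1)` have at most one element each, and their union is
a vertex cover. -/
def IsCoverList (k : ℕ) (D : ℕ → V → Prop) : Prop :=
  (∀ l < k, ∀ a b, D l a → D l b → a = b) ∧ ∀ a b : V, Edge a b → ∃ l < k, D l a ∨ D l b

/-- Soundness of both kinds of disjunct: sending a defined vertex to an index that defines it is
injective. -/
theorem IsCoverList.exists_finset [Finite V] {k : ℕ} {D : ℕ → V → Prop} (h : IsCoverList k D) :
    ∃ C : Finset V, C.card ≤ k ∧ ∀ a b, Edge a b → a ∈ C ∨ b ∈ C := by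
  classical
  have := Fintype.ofFinite V
  refine ⟨Finset.univ.filter fun x => ∃ l < k, D l x, ?_, fun a b hab => ?_⟩
  · have hc : ∀ x ∈ Finset.univ.filter fun x => ∃ l < k, D l x, ∃ l ∈ Finset.range k, D l x := by
      simp
    choose! g hg hD using hc
    refine (Finset.card_le_card_of_injOn g hg fun x hx y hy hxy => ?_).trans
      (Finset.card_range k).le
    exact h.1 _ (Finset.mem_range.1 (hg x hx)) x y (hD x hx) (hxy ▸ hD y hy)
  · obtain ⟨l, hl, hab | hab⟩ := h.2 a b hab
    · exact Or.inl (by simpa using ⟨l, hl, hab⟩)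
    · exact Or.inr (by simpa using ⟨l, hl, hab⟩)

theorem isCoverList_of_forall_iff {k : ℕ} {C : Finset V} {f : ℕ → V} {D : ℕ → V → Prop}
    (hC : ∀ a b, Edge a b → a ∈ C ∨ b ∈ C) (hf : ∀ x ∈ C, ∃ l < k, f l = x)
    (hD : ∀ l < k, ∀ x, D l x ↔ x = f l) : IsCoverList k D := by
  refine ⟨fun l hl a b ha hb => ((hD l hl a).1 ha).trans ((hD l hl b).1 hb).symm, fun a b hab => ?_⟩
  rcases hC a b hab with h | h
  · obtain ⟨l, hl, rfl⟩ := hf _ h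
    exact ⟨l, hl, Or.inl ((hD l hl _).2 rfl)⟩
  · obtain ⟨l, hl, rfl⟩ := hf _ h
    exact ⟨l, hl, Or.inr ((hD l hl _).2 rfl)⟩

theorem exists_enumeration {α : Type*} {C : Finset α} (hC : C.Nonempty) {k : ℕ}
    (hk : C.card ≤ k) : ∃ f : ℕ → α, (∀ l, f l ∈ C) ∧ ∀ x ∈ C, ∃ l < k, f l = x := by
  obtain ⟨x₀, hx₀⟩ := hC
  refine ⟨fun l => if h : l < C.card then C.equivFin.symm ⟨l, h⟩ else x₀, fun l => ?_,
    fun x hx => ⟨C.equivFin ⟨x, hx⟩, (Fin.isLt _).trans_le hk, by simp⟩⟩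
  dsimp only
  split
  · exact Subtype.coe_prop _
  · exact hx₀

/-- In a minimal vertex cover every vertex has a neighbour outside the cover. -/
theorem exists_minimal_cover (hirr : ∀ a : V, ¬ Edge a a) (hsymm : ∀ a b : V, Edge a b → Edge b a)
    {C : Finset V} (hC : ∀ a b, Edge a b → a ∈ C ∨ b ∈ C) :
    ∃ C' ⊆ C, (∀ a b, Edge a b → a ∈ C' ∨ b ∈ C') ∧ ∀ x ∈ C', ∃ y ∉ C', Edge x y := by
  classical
  obtain ⟨C', hC', hmin⟩ := exists_minimal_le_of_wellFoundedLT
    (fun C : Finset V => ∀ a b, Edge a b → a ∈ C ∨ b ∈ C) C hC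
  refine ⟨C', hC', hmin.1, fun x hx => ?_⟩
  by_contra! hno
  -- If all neighbours of `x` were in the cover, `x` could be removed, as there are no loops.
  have hcov : ∀ a b, Edge a b → a ∈ C'.erase x ∨ b ∈ C'.erase x := by
    intro a b hab
    have hne : a ≠ b := fun h => hirr b (h ▸ hab)
    by_cases ha : a = x
    · subst ha
      exact Or.inr (Finset.mem_erase.2 ⟨hne.symm, by_contra fun h => hno b h hab⟩)
    · by_cases hb : b = x
      · subst hb
        exact Or.inl (Finset.mem_erase.2 ⟨ha, by_contra fun h => hno a h (hsymm _ _ hab)⟩)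
      · simpa [ha, hb] using hmin.1 a b hab
  exact Finset.notMem_erase x C' (hmin.2 hcov (Finset.erase_subset x C') hx)

/-- A pair of colours for each vertex of a minimal vertex cover determines the vertex cover. -/
theorem exists_colors_of_cover (e : ArithIso V n) {k : ℕ} (hn : 4 ^ ((2 * k) ^ 2 + 12) ≤ n)
    (hirr : ∀ a : V, ¬ Edge a a) (hsymm : ∀ a b : V, Edge a b → Edge b a)
    {C : Finset V} (hk : C.card ≤ k) (hC : ∀ a b, Edge a b → a ∈ C ∨ b ∈ C)
    (hne : ∃ a b : V, Edge a b) :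
    ∃ (p q : V) (i j : ℕ → ℕ), e.val p * e.val p ≤ n ∧ e.val q < e.val p ∧
      (∀ l, i l < (2 * k) ^ 2 + 1) ∧ (∀ l, j l < (2 * k) ^ 2 + 1) ∧
      IsCoverList k fun l z => ∃ y, Edge z y ∧
        hashColor (e.val p) (e.val q) ((2 * k) ^ 2 + 1) (e.val z) = i l ∧
        hashColor (e.val p) (e.val q) ((2 * k) ^ 2 + 1) (e.val y) = j l := by
  classical
  obtain ⟨C', hC'C, hC', hpriv⟩ := exists_minimal_cover hirr hsymm hC
  choose! g hg hEg using hpriv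
  have hk' : C'.card ≤ k := (Finset.card_le_card hC'C).trans hk
  have hCne : C'.Nonempty := by
    obtain ⟨a, b, hab⟩ := hne
    rcases hC' a b hab with h | h
    exacts [⟨a, h⟩, ⟨b, h⟩]
  obtain ⟨f, hfC, hf⟩ := exists_enumeration hCne hk'
  have hX : ((C' ∪ C'.image g).image e.val).card ≤ 2 * k := by
    refine Finset.card_image_le.trans ((Finset.card_union_le _ _).trans ?_)
    have := Finset.card_image_le (s := C') (f := g)
    omega
  obtain ⟨p, q, hpn, hqp, hpp, hinj⟩ := exists_hashColor_injOn hX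
    (fun x hx => by
      obtain ⟨y, -, rfl⟩ := Finset.mem_image.1 hx
      exact e.val_lt y) hn
  obtain ⟨p, rfl⟩ := e.exists_val_eq hpn
  obtain ⟨q, rfl⟩ := e.exists_val_eq (hqp.trans hpn)
  have hinj' : ∀ x ∈ C' ∪ C'.image g, ∀ y ∈ C' ∪ C'.image g,
      hashColor (e.val p) (e.val q) ((2 * k) ^ 2 + 1) (e.val x) =
        hashColor (e.val p) (e.val q) ((2 * k) ^ 2 + 1) (e.val y) → x = y :=
    fun x hx y hy h => e.val_injective (hinj (Finset.mem_coe.2 (Finset.mem_image_of_mem _ hx))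
      (Finset.mem_coe.2 (Finset.mem_image_of_mem _ hy)) h)
  refine ⟨p, q, fun l => hashColor (e.val p) (e.val q) ((2 * k) ^ 2 + 1) (e.val (f l)),
    fun l => hashColor (e.val p) (e.val q) ((2 * k) ^ 2 + 1) (e.val (g (f l))), hpp, hqp,
    fun l => Nat.mod_lt _ (Nat.succ_pos _), fun l => Nat.mod_lt _ (Nat.succ_pos _),
    isCoverList_of_forall_iff hC' hf fun l _ z => ⟨?_, ?_⟩⟩
  · rintro ⟨y, hzy, hz, hy⟩
    by_cases hzC : z ∈ C'
    · exact hinj' _ (Finset.mem_union_left _ hzC) _ (Finset.mem_union_left _ (hfC l)) hz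
    -- Here `z` is not among the hashed vertices, so its own colour says nothing; its neighbour `y`
    -- is among them and would have to equal `g (f l)`, which lies outside the cover.
    · have hyC : y ∈ C' := (hC' z y hzy).resolve_left hzC
      have := hinj' _ (Finset.mem_union_left _ hyC) _
        (Finset.mem_union_right _ (Finset.mem_image_of_mem g (hfC l))) hy
      exact absurd (this ▸ hyC) (hg _ (hfC l))
  · rintro rfl
    exact ⟨g (f l), hEg _ (hfC l), rfl, rfl⟩

/-! ### Truth of the sentences in arithmetical structures -/

variable [Nonempty V] {s : ℕ → V} {H k : ℕ}

theorem sat_sizeF (e : ArithIso V n) (hk : k ≤ H) :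
    Sat (fun ℓ : Fin (H + 1) => e.const ℓ) (sizeF H k) s ↔ k ≤ n := by
  have hn := e.pos
  simp only [sizeF, sat_bigAnd, sat_notF, sat_eqF, tmVal_cst]
  constructor
  · intro h
    by_contra! hnk
    refine h (n - 1) (by omega) (e.val_injective ?_)
    rw [e.const_ofNat (by omega), e.const_ofNat (by omega), e.val_const, e.val_const]
    split_ifs <;> omega
  · intro h l hl heq
    have := congrArg e.val heq
    rw [e.const_ofNat (by omega), e.const_ofNat (by omega), e.val_const_of_lt (by omega),
      e.val_const_of_lt (by omega)] at this
    omega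

theorem sat_smallCoverF (e : ArithIso V n) {N : ℕ} :
    Sat (fun ℓ : Fin (H + 1) => e.const ℓ) (smallCoverF H N k) s ↔
      ∃ t < N ^ k, IsCoverList k fun l z =>
        z = e.const (Fin.ofNat (H + 1) (digit N t l) : Fin (H + 1)) := by
  simp only [smallCoverF, sat_bigOr]
  exact exists_congr fun t => and_congr_right fun _ => sat_coverF fun l z s' _ _ => by simp

theorem sat_colorCoverF (e : ArithIso V n) {M : ℕ} :
    Sat (fun ℓ : Fin (H + 1) => e.const ℓ) (colorCoverF H M k) s ↔
      ∃ t < (M * M) ^ k, IsCoverList k fun l z => ∃ y, Edge z y ∧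
        ColorRel (s 0) (s 1) (e.const (Fin.ofNat (H + 1) M : Fin (H + 1)))
          (e.const (Fin.ofNat (H + 1) (digit (M * M) t l / M) : Fin (H + 1))) z ∧
        ColorRel (s 0) (s 1) (e.const (Fin.ofNat (H + 1) M : Fin (H + 1)))
          (e.const (Fin.ofNat (H + 1) (digit (M * M) t l % M) : Fin (H + 1))) y := by
  simp only [colorCoverF, sat_bigOr]
  refine exists_congr fun t => and_congr_right fun _ => sat_coverF fun l z s' h0 h1 => ?_
  rw [sat_colorEdgeF, h0, h1]

theorem sat_smallCoverF_of_le (e : ArithIso V n) (hn : n ≤ H) {C : Finset V} (hk : C.card ≤ k)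
    (hCne : C.Nonempty) (hC : ∀ a b, Edge a b → a ∈ C ∨ b ∈ C) :
    Sat (fun ℓ : Fin (H + 1) => e.const ℓ) (smallCoverF H H k) s := by
  obtain ⟨f, -, hf⟩ := exists_enumeration hCne hk
  have hlt (l : ℕ) := e.val_lt (f l)
  obtain ⟨t, ht, hd⟩ := exists_digit_eq (B := H) (k := k) (f := fun l => e.val (f l))
    fun l _ => (hlt l).trans_le hn
  refine (sat_smallCoverF e).2 ⟨t, ht, isCoverList_of_forall_iff hC hf fun l hl x => ?_⟩
  rw [hd l hl, e.const_ofNat ((hlt l).le.trans hn),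
    e.val_injective (e.val_const_of_lt (hlt l))]

theorem sat_colorCoverF_of_le (e : ArithIso V n) (hHn : H ≤ n)
    (hH : H = 4 ^ ((2 * k) ^ 2 + 12)) (hirr : ∀ a : V, ¬ Edge a a)
    (hsymm : ∀ a b : V, Edge a b → Edge b a) {C : Finset V} (hk : C.card ≤ k)
    (hC : ∀ a b, Edge a b → a ∈ C ∨ b ∈ C) (hne : ∃ a b : V, Edge a b) :
    ∃ p q, ∀ s : ℕ → V, s 0 = p → s 1 = q →
      Sat (fun ℓ : Fin (H + 1) => e.const ℓ) (colorCoverF H ((2 * k) ^ 2 + 1) k) s := by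
  obtain ⟨p, q, i, j, hp, hq, hi, hj, hcov⟩ :=
    exists_colors_of_cover e (hH ▸ hHn) hirr hsymm hk hC hne
  have hMH : (2 * k) ^ 2 + 1 < H := by
    have : (2 * k) ^ 2 + 12 < 4 ^ ((2 * k) ^ 2 + 12) := Nat.lt_pow_self (by norm_num)
    omega
  generalize (2 * k) ^ 2 + 1 = M at *
  have hval {c : ℕ} (hc : c ≤ M) : e.val (e.const (Fin.ofNat (H + 1) c : Fin (H + 1))) = c := by
    rw [e.const_ofNat (by omega), e.val_const_of_lt (by omega)]
  -- A pair of colours is packed into one digit in base `M * M`.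
  obtain ⟨t, ht, hd⟩ := exists_digit_eq (B := M * M) (k := k) (f := fun l => i l * M + j l)
    fun l _ => by nlinarith [hi l, hj l]
  refine ⟨p, q, fun s h0 h1 => (sat_colorCoverF e).2 ⟨t, ht, ?_⟩⟩
  have hdiv (l : ℕ) : (i l * M + j l) / M = i l := by
    rw [mul_comm, Nat.mul_add_div ((Nat.zero_le _).trans_lt (hi l)), Nat.div_eq_of_lt (hj l),
      add_zero]
  have hmod (l : ℕ) : (i l * M + j l) % M = j l := by
    rw [mul_comm, Nat.mul_add_mod, Nat.mod_eq_of_lt (hj l)]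
  have key : ∀ l < k, ∀ z, (∃ y, Edge z y ∧
        ColorRel (s 0) (s 1) (e.const (Fin.ofNat (H + 1) M : Fin (H + 1)))
          (e.const (Fin.ofNat (H + 1) (digit (M * M) t l / M) : Fin (H + 1))) z ∧
        ColorRel (s 0) (s 1) (e.const (Fin.ofNat (H + 1) M : Fin (H + 1)))
          (e.const (Fin.ofNat (H + 1) (digit (M * M) t l % M) : Fin (H + 1))) y) ↔
      ∃ y, Edge z y ∧ hashColor (e.val p) (e.val q) M (e.val z) = i l ∧
        hashColor (e.val p) (e.val q) M (e.val y) = j l := by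
    intro l hl z
    rw [hd l hl, hdiv, hmod, h0, h1]
    exact exists_congr fun y => and_congr_right fun _ => and_congr
      (e.colorRel_iff hp hq (hval le_rfl) (hval (hi l).le) (hi l))
      (e.colorRel_iff hp hq (hval le_rfl) (hval (hj l).le) (hj l))
  refine ⟨fun l hl a b ha hb => hcov.1 l hl a b ((key l hl a).1 ha) ((key l hl b).1 hb),
    fun a b hab => ?_⟩
  obtain ⟨l, hl, h⟩ := hcov.2 a b hab
  exact ⟨l, hl, h.imp (key l hl a).2 (key l hl b).2⟩

theorem sat_vertexCoverF (e : ArithIso V n) (hH : H = 4 ^ ((2 * k) ^ 2 + 12)) :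
    Sat (fun ℓ : Fin (H + 1) => e.const ℓ) (vertexCoverF H H ((2 * k) ^ 2 + 1) k) s ↔
      ((∀ a : V, ¬ Edge a a) ∧ ∀ a b : V, Edge a b → Edge b a) ∧
        ∃ C : Finset V, (∀ a b, Edge a b → a ∈ C ∨ b ∈ C) ∧ C.card = k := by
  classical
  have : Finite V := Finite.of_equiv _ e.toEquiv.symm
  have := Fintype.ofFinite V
  have hcard : Fintype.card V = n := by rw [Fintype.card_congr e.toEquiv, Fintype.card_fin]
  have hkH : k ≤ H := by
    have : (2 * k) ^ 2 + 12 < 4 ^ ((2 * k) ^ 2 + 12) := Nat.lt_pow_self (by norm_num)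
    nlinarith
  rw [vertexCoverF, sat_andF, sat_andF, sat_graphF, sat_sizeF e hkH]
  refine and_congr_right fun hgraph => ?_
  simp only [sat_exF, sat_orF]
  constructor
  · rintro ⟨hkn, p, q, h⟩
    obtain ⟨C, hCk, hC⟩ : ∃ C : Finset V, C.card ≤ k ∧ ∀ a b, Edge a b → a ∈ C ∨ b ∈ C := by
      rcases h with h | h
      · obtain ⟨t, -, h⟩ := (sat_smallCoverF e).1 h
        exact h.exists_finset
      · obtain ⟨t, -, h⟩ := (sat_colorCoverF e).1 h
        exact h.exists_finset
    -- Supersets of covers are covers, and `k ≤ n` leaves room for exactly `k` vertices.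
    obtain ⟨C', hCC', hC'⟩ := Finset.exists_superset_card_eq hCk (hkn.trans hcard.ge)
    exact ⟨C', fun a b hab => (hC a b hab).imp (@hCC' a) (@hCC' b), hC'⟩
  · rintro ⟨C, hC, hCk⟩
    refine ⟨hCk ▸ hcard ▸ Finset.card_le_univ C, ?_⟩
    by_cases hne : ∃ a b : V, Edge a b
    · rcases le_total H n with hHn | hHn
      · obtain ⟨p, q, h⟩ := sat_colorCoverF_of_le e hHn hH hgraph.1 hgraph.2 hCk.le hC hne
        exact ⟨p, q, Or.inr (h _ (by simp) (by simp))⟩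
      · obtain ⟨a, b, hab⟩ := hne
        have hCne : C.Nonempty := (hC a b hab).elim (fun h => ⟨a, h⟩) fun h => ⟨b, h⟩
        exact ⟨a, b, Or.inl (sat_smallCoverF_of_le e hHn hCk.le hCne hC)⟩
    -- Without edges the cover may be empty and have no enumeration, but any list of constants
    -- works.
    · obtain ⟨a⟩ := ‹Nonempty V›
      refine ⟨a, a, Or.inl ((sat_smallCoverF e).2 ⟨0, ?_, ?_, ?_⟩)⟩
      · exact Nat.pow_pos (hH ▸ by positivity)
      · exact fun l _ x y hx hy => hx.trans hy.symm
      · exact fun x y hxy => absurd ⟨x, y, hxy⟩ hne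

theorem pVC_mem_iff : pVC.Mem V k ↔ IsArithm V ∧
    ((∀ a : V, ¬ Edge a a) ∧ ∀ a b : V, Edge a b → Edge b a) ∧
      ∃ C : Finset V, (∀ a b, Edge a b → a ∈ C ∨ b ∈ C) ∧ C.card = k := by
  refine and_congr_right fun _ => ⟨?_, ?_⟩
  · rintro ⟨G, hG, C, hC, hk⟩
    exact ⟨⟨fun a ha => G.irrefl ((hG a a).2 ha), fun a b hab => (hG b a).1 ((hG a b).2 hab).symm⟩,
      C, fun a b hab => hC ((hG a b).2 hab), hk⟩
  · rintro ⟨⟨hirr, hsymm⟩, C, hC, hk⟩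
    exact ⟨⟨Edge, ⟨fun a b => hsymm a b⟩, ⟨hirr⟩⟩, fun _ _ => Iff.rfl, C,
      fun a b hab => hC a b hab, hk⟩

end Correctness

end SlicewiseFO

theorem mainTheorem3 : SlicewiseFO.SlicewiseDefinable.{u} SlicewiseFO.pVC.{u} 16 := by
  have hM : Primrec fun k : ℕ => (2 * k) ^ 2 + 1 :=
    Primrec.succ.comp (SlicewiseFO.primrec_pow.comp Primrec.nat_double (Primrec.const 2))
  have hH : Primrec fun k : ℕ => 4 ^ ((2 * k) ^ 2 + 12) :=
    SlicewiseFO.primrec_pow.comp (Primrec.const 4) (Primrec.nat_add.comp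
      (SlicewiseFO.primrec_pow.comp Primrec.nat_double (Primrec.const 2)) (Primrec.const 12))
  -- The threshold `H` between small and large structures comes from hashing `2 * k` elements; `H +
  -- 1` constants provide names for all numbers up to `H`.
  refine ⟨fun k => 4 ^ ((2 * k) ^ 2 + 12) + 1,
    fun k => SlicewiseFO.vertexCoverF (4 ^ ((2 * k) ^ 2 + 12)) (4 ^ ((2 * k) ^ 2 + 12))
      ((2 * k) ^ 2 + 1) k, (Primrec.succ.comp hH).to_comp,
    (SlicewiseFO.primFm_vertexCoverF hH hH hM Primrec.id).to_comp,
    fun k => SlicewiseFO.quantifierRank_vertexCoverF_le _ _ _ _, ?_⟩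
  intro V _ _ n e k
  rw [SlicewiseFO.pVC_mem_iff, e.models_iff_sat _ fun _ => Classical.arbitrary V]
  rw [SlicewiseFO.sat_vertexCoverF e rfl]
  exact and_iff_right ⟨n, ⟨e⟩⟩
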